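/- **Conventions.** A *fusion algebra* $(R,d)$ consists of a set $I$ (irreducible objects) with a distinguished element $e$ and an involution $\alpha\mapsto\bar\alpha$, a unital ring structure on $R=\mathbb Z[I]$ with unit $e$ and products $\xi\eta=\sum_{\alpha} N_{\xi,\eta}^{\alpha}\,\alpha$ (finite sums, $N_{\xi,\eta}^\alpha\in\mathbb Z_{\ge 0}$), such that the involution is antimultiplicative and $N_{\xi,\eta}^{\alpha}=N_{\alpha,\bar\eta}^{\xi}=N_{\bar\xi,\alpha}^{\eta}$, and a multiplicative $\mathbb Z$-linear map $d\colon R\to\mathbb R$ with $d(\bar\alpha)=d(\alpha)\ge 1$ for $\alpha\in I$. For finite $A\subseteq I$ put $|A|=\sum_{\alpha\in A}d(\alpha)^2$. A finite set $X\subseteq I$ is *generating* if $\overline X=X$ and every $\alpha\in I$ lies in the support of a product $x_1\cdots x_n$ with $n\ge 1$ and $x_i\in X$; $R$ is *finitely generated* if such an $X$ exists. For finite $X,A\subseteq I$ put $$\partial_X^{\mathrm{inn}}A=\{\alpha\in A:\exists x\in X,\ \operatorname{supp}(\alpha x)\not\subseteq A\},\qquad \partial_XA=\partial_X^{\mathrm{inn}}A\cup\{\alpha\in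 A^c:\exists x\in X,\ \operatorname{supp}(\alpha x)\not\subseteq A^c\}.$$ The uniform Følner constant and the uniform inner Følner constant of a finitely generated $(R,d)$ are $$\mathrm{F\o l}(R)=\inf_X\inf_A\frac{|\partial_XA|}{|A|},\qquad \mathrm{F\o l}^{\mathrm{inn}}(R)=\inf_X\inf_A\frac{|\partial^{\mathrm{inn}}_XA|}{|A|},$$ where $X$ runs over the finite generating sets and $A$ over the non-empty finite subsets of $I$. For $q\in(0,1]$, $R(SO_q(3))$ is the fusion algebra with $I=\{0,1,2,\dots\}$, unit $0$, trivial involution, fusion rules $$m\otimes n=|m-n|\oplus(|m-n|+1)\oplus\cdots\oplus(m+n),$$ and the dimension function determined by $d(1)=[3]_q=q^2+q^{-2}+1$. For an integer $N\ge 4$, $R(S_N^+)$ is the fusion algebra with the same irreducible objects, involution and fusion rules, and the dimension function determined by $d(1)=N-1$. **Proposition.** 1. For every $q\in(0,1]$ the fusion algebra $R(SO_q(3))$ is finitely generated and $$\mathrm{F\o l}^{\mathrm{inn}}(R(SO_q(3)))=1-q^4,\qquad \mathrm{F\o l}(R(SO_q(3)))=q^{-4}-q^4 .$$ 2. The same conclusions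 hold for every fusion algebra whose irreducible objects can be labelled by $0,1,2,\dots$ so that the above fusion rules hold and $d(1)=q^2+q^{-2}+1$, $q\in(0,1]$. 3. In particular, for every integer $N\ge4$ the fusion algebra $R(S_N^+)$ of the quantum permutation group is finitely generated and $$\mathrm{F\o l}^{\mathrm{inn}}(R(S_N^+))=1-\frac{\bigl(N-2-\sqrt{N^2-4N}\bigr)^2}{4},\qquad \mathrm{F\o l}(R(S_N^+))=\frac{4}{\bigl(N-2-\sqrt{N^2-4N}\bigr)^2}-\frac{\bigl(N-2-\sqrt{N^2-4N}\bigr)^2}{4}.$$ -/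

import Mathlib

universe u

/-- A fusion algebra `(R, d)`: a ring structure on the free abelian group `ℤ[I]`, given by its
non-negative structure constants `N ξ η α` in the basis `I` (that is, `ξ η = ∑ α, N ξ η α • α`, a
finite sum), with unit `e`, an involution, Frobenius reciprocity, and a dimension function `d`,
given by its values on the basis and extended linearly to `ℤ[I]`. -/
structure FusionAlgebra where
  /-- the irreducible objects -/
  I : Type u
  /-- the distinguished element, unit of the ring -/
  e : I
  /-- the involution `α ↦ ᾱ` -/
  conj : I → I
  /-- the fusion multiplicities -/
  N : I → I → I →₀ ℕ
  /-- the dimension function -/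
  d : I → ℝ
  unit_mul : ∀ ξ, N e ξ = Finsupp.single ξ 1
  mul_unit : ∀ ξ, N ξ e = Finsupp.single ξ 1
  /-- the coefficients of `δ` in `(α β) γ` and in `α (β γ)` agree -/
  mul_assoc : ∀ α β γ δ, ((N α β).sum fun ε k => k * N ε γ δ) =
    (N β γ).sum fun ε k => k * N α ε δ
  conj_conj : ∀ α, conj (conj α) = α
  /-- the involution is antimultiplicative -/
  conj_mul : ∀ ξ η α, N (conj η) (conj ξ) (conj α) = N ξ η α
  frobenius_right : ∀ ξ η α, N ξ η α = N α (conj η) ξ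
  frobenius_left : ∀ ξ η α, N ξ η α = N (conj ξ) α η
  d_mul : ∀ ξ η, d ξ * d η = (N ξ η).sum fun α k => (k : ℝ) * d α
  d_conj : ∀ α, d (conj α) = d α
  one_le_d : ∀ α, 1 ≤ d α

namespace FusionAlgebra

variable (F : FusionAlgebra.{u})

/-- The product `x₁ ⋯ xₙ` of irreducible objects, as an element of `ℕ[I] ⊆ ℤ[I]`. -/
noncomputable def prod : List F.I → (F.I →₀ ℕ)
  | [] => Finsupp.single F.e 1
  | x :: l => (prod l).sum fun η k => k • F.N x η

/-- `X` is a (symmetric, finite) generating set: `X̄ = X`, and each irreducible object `α` satisfies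
`α ⊆ x₁ ⋯ xₙ` for some `n ≥ 1` and `x₁, …, xₙ ∈ X`. -/
def Generates (X : Finset F.I) : Prop :=
  (∀ x ∈ X, F.conj x ∈ X) ∧
    ∀ α, ∃ l : List F.I, l ≠ [] ∧ (∀ x ∈ l, x ∈ X) ∧ α ∈ (F.prod l).support

/-- The fusion algebra is finitely generated. -/
def FinitelyGenerated : Prop := ∃ X : Finset F.I, F.Generates X

/-- The inner boundary of `A` with respect to `X`. -/
def innerBoundary (X A : Finset F.I) : Set F.I :=
  {α | α ∈ A ∧ ∃ x ∈ X, ¬ (∀ β ∈ (F.N α x).support, β ∈ A)}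

/-- The boundary of `A` with respect to `X`. -/
def boundary (X A : Finset F.I) : Set F.I :=
  {α | α ∈ A ∧ ∃ x ∈ X, ¬ (∀ β ∈ (F.N α x).support, β ∈ A)} ∪
    {α | α ∉ A ∧ ∃ x ∈ X, ¬ (∀ β ∈ (F.N α x).support, β ∉ A)}

theorem finite_boundary (X A : Finset F.I) : (F.boundary X A).Finite := by
  have h : (⋃ b ∈ A, ⋃ x ∈ X, ((F.N b (F.conj x)).support : Set F.I)).Finite :=
    A.finite_toSet.biUnion fun b _ => X.finite_toSet.biUnion fun x _ => Finset.finite_toSet _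
  refine (A.finite_toSet.union h).subset ?_
  rintro α (⟨hα, -⟩ | ⟨-, x, hx, hn⟩)
  · exact Or.inl hα
  · push Not at hn
    obtain ⟨β, hβ, hA⟩ := hn
    refine Or.inr ?_
    simp only [Set.mem_iUnion]
    refine ⟨β, hA, x, hx, ?_⟩
    have := F.frobenius_right α x β
    simp only [Finset.mem_coe, Finsupp.mem_support_iff] at hβ ⊢
    rwa [← this]

/-- The size `|A| = ∑_{α ∈ A} d(α)²` (only used for finite sets `A`). -/
noncomputable def size (A : Set F.I) : ℝ := ∑ᶠ α ∈ A, F.d α ^ 2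

/-- The Følner constant with respect to `X`. -/
noncomputable def folWith (X : Finset F.I) : ℝ :=
  ⨅ A : {A : Finset F.I // A.Nonempty}, F.size (F.boundary X A) / F.size (A : Finset F.I)

/-- The inner Følner constant with respect to `X`. -/
noncomputable def folInnWith (X : Finset F.I) : ℝ :=
  ⨅ A : {A : Finset F.I // A.Nonempty}, F.size (F.innerBoundary X A) / F.size (A : Finset F.I)

/-- The uniform Følner constant (of a finitely generated fusion algebra). -/
noncomputable def fol : ℝ := ⨅ X : {X : Finset F.I // F.Generates X}, F.folWith X

/-- The uniform inner Følner constant (of a finitely generated fusion algebra). -/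
noncomputable def folInn : ℝ := ⨅ X : {X : Finset F.I // F.Generates X}, F.folInnWith X

/-- `φ` labels the irreducible objects of `F` by `0, 1, 2, …` so that the fusion rules are
`m ⊗ n = |m - n| ⊕ (|m - n| + 1) ⊕ ⋯ ⊕ (m + n)`. -/
def HasSO3FusionRules (φ : ℕ ≃ F.I) : Prop :=
  ∀ m n k, F.N (φ m) (φ n) (φ k) = if Nat.dist m n ≤ k ∧ k ≤ m + n then 1 else 0

end FusionAlgebra

/-- The fusion multiplicities `m ⊗ n = |m - n| ⊕ (|m - n| + 1) ⊕ ⋯ ⊕ (m + n)` on `ℕ`. -/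
noncomputable def so3Mult (m n : ℕ) : ℕ →₀ ℕ :=
  Finsupp.indicator (Finset.Icc (Nat.dist m n) (m + n)) fun _ _ => 1

/-- The dimension function with `d 0 = 1`, `d 1 = t`, determined by
`d (n + 1) * d 1 = d (n + 2) + d (n + 1) + d n`. -/
def so3Dim (t : ℝ) : ℕ → ℝ
  | 0 => 1
  | 1 => t
  | n + 2 => so3Dim t (n + 1) * t - so3Dim t (n + 1) - so3Dim t n

theorem so3Mult_apply (m n k : ℕ) :
    so3Mult m n k = if Nat.dist m n ≤ k ∧ k ≤ m + n then 1 else 0 := by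
  simp [so3Mult, Finsupp.indicator_apply]

theorem so3Mult_sum {M : Type*} [AddCommMonoid M] (m n : ℕ) (f : ℕ → ℕ → M)
    (hf : ∀ i, f i 0 = 0) :
    (so3Mult m n).sum f = ∑ k ∈ Finset.Icc (Nat.dist m n) (m + n), f k 1 := by
  rw [Finsupp.sum_of_support_subset _
    (show (so3Mult m n).support ⊆ _ from Finsupp.support_indicator_subset _ _) _ fun i _ => hf i]
  refine Finset.sum_congr rfl fun k hk => ?_
  rw [Finset.mem_Icc] at hk
  rw [so3Mult_apply, if_pos hk]

theorem so3Mult_assoc (α β γ δ : ℕ) : ((so3Mult α β).sum fun ε k => k * so3Mult ε γ δ) =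
    (so3Mult β γ).sum fun ε k => k * so3Mult α ε δ := by
  rw [so3Mult_sum _ _ _ (by simp), so3Mult_sum _ _ _ (by simp)]
  simp only [so3Mult_apply, one_mul, Finset.sum_boole, Nat.cast_id]
  have h1 : (Finset.Icc (Nat.dist α β) (α + β)).filter
      (fun x => Nat.dist x γ ≤ δ ∧ δ ≤ x + γ) =
      Finset.Icc (max (Nat.dist α β) (Nat.dist γ δ)) (min (α + β) (γ + δ)) := by
    ext x
    rw [Finset.mem_filter, Finset.mem_Icc, Finset.mem_Icc]
    simp only [Nat.dist]
    omega
  have h2 : (Finset.Icc (Nat.dist β γ) (β + γ)).filter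
      (fun x => Nat.dist α x ≤ δ ∧ δ ≤ α + x) =
      Finset.Icc (max (Nat.dist β γ) (Nat.dist α δ)) (min (β + γ) (α + δ)) := by
    ext x
    rw [Finset.mem_filter, Finset.mem_Icc, Finset.mem_Icc]
    simp only [Nat.dist]
    omega
  rw [h1, h2, Nat.card_Icc, Nat.card_Icc]
  have hd : ∀ a b, (b ≤ a ∧ Nat.dist a b + b = a) ∨ (a ≤ b ∧ Nat.dist a b + a = b) := by
    intro a b
    simp only [Nat.dist]
    omega
  have a1 := hd α β
  have a2 := hd γ δ
  have a3 := hd β γ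
  have a4 := hd α δ
  generalize Nat.dist α β = x at *
  generalize Nat.dist γ δ = y at *
  generalize Nat.dist β γ = z at *
  generalize Nat.dist α δ = w at *
  clear h1 h2 hd
  rcases a1 with ⟨-, a1⟩ | ⟨-, a1⟩ <;> rcases a2 with ⟨-, a2⟩ | ⟨-, a2⟩ <;>
    rcases a3 with ⟨-, a3⟩ | ⟨-, a3⟩ <;> rcases a4 with ⟨-, a4⟩ | ⟨-, a4⟩ <;> omega

theorem so3Dim_mono {t : ℝ} (ht : 3 ≤ t) (n : ℕ) :
    1 ≤ so3Dim t n ∧ so3Dim t n ≤ so3Dim t (n + 1) := by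
  induction n with
  | zero => exact ⟨le_refl _, by simp only [so3Dim]; linarith⟩
  | succ n ih =>
    refine ⟨ih.1.trans ih.2, ?_⟩
    rw [so3Dim]
    nlinarith [ih.1, ih.2]

theorem so3Dim_mul_add (t : ℝ) (n : ℕ) : ∀ j, so3Dim t (j + n) * so3Dim t n =
    ∑ i ∈ Finset.range (2 * n + 1), so3Dim t (j + i) := by
  induction n using Nat.twoStepInduction with
  | zero => intro j; simp [so3Dim]
  | one =>
    intro j
    simp only [Finset.sum_range_succ, Finset.sum_range_zero, so3Dim]
    simp only [add_zero]
    ring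
  | more n h0 h1 =>
    intro j
    have e0 := h0 (j + 2)
    have e1 := h1 (j + 1)
    rw [show j + 2 + n = j + (n + 2) by ring] at e0
    rw [show j + 1 + (n + 1) = j + (n + 2) by ring] at e1
    have key : ∀ k, ∑ i ∈ Finset.range k, so3Dim t (j + 2 + i) =
        (t - 1) * ∑ i ∈ Finset.range k, so3Dim t (j + 1 + i) -
          ∑ i ∈ Finset.range k, so3Dim t (j + i) := by
      intro k
      rw [Finset.mul_sum, ← Finset.sum_sub_distrib]
      refine Finset.sum_congr rfl fun i _ => ?_
      rw [show j + 2 + i = j + i + 2 by ring, show j + 1 + i = j + i + 1 by ring, so3Dim]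
      ring
    have k3 := key (2 * (n + 1) + 1)
    rw [so3Dim]
    rw [show 2 * (n + 2) + 1 = 2 * n + 1 + 1 + 1 + 1 + 1 by ring]
    rw [show 2 * (n + 1) + 1 = 2 * n + 1 + 1 + 1 by ring] at k3 e1
    simp only [Finset.sum_range_succ _ (2 * n + 1), Finset.sum_range_succ _ (2 * n + 1 + 1),
      Finset.sum_range_succ _ (2 * n + 1 + 1 + 1),
      Finset.sum_range_succ _ (2 * n + 1 + 1 + 1 + 1)] at k3 e1 ⊢
    rw [show j + 2 + (2 * n + 1) = j + (2 * n + 1 + 1 + 1) by ring,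
      show j + 2 + (2 * n + 1 + 1) = j + (2 * n + 1 + 1 + 1 + 1) by ring] at k3
    linear_combination (t - 1) * e1 - e0 - k3

theorem so3Dim_mul (t : ℝ) (m n : ℕ) : so3Dim t m * so3Dim t n =
    (so3Mult m n).sum fun α k => (k : ℝ) * so3Dim t α := by
  rw [so3Mult_sum _ _ _ (by simp)]
  simp only [Nat.cast_one, one_mul]
  wlog h : n ≤ m generalizing m n
  · rw [mul_comm, this n m (by omega), Nat.dist_comm, add_comm]
  obtain ⟨j, rfl⟩ := Nat.exists_eq_add_of_le' h
  rw [so3Dim_mul_add, ← Finset.Ico_succ_right_eq_Icc, Finset.sum_Ico_eq_sum_range]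
  have h1 : Nat.dist (j + n) n = j := by simp [Nat.dist]
  rw [h1]
  congr 2
  simp only [Order.succ_eq_add_one]
  omega

/-- The fusion algebra with irreducible objects `ℕ`, unit `0`, trivial involution, fusion rules
`m ⊗ n = |m - n| ⊕ (|m - n| + 1) ⊕ ⋯ ⊕ (m + n)`, and the dimension function with `d(1) = t`. -/
noncomputable def so3Fusion (t : ℝ) (ht : 3 ≤ t) : FusionAlgebra.{0} where
  I := ℕ
  e := 0
  conj := id
  N := so3Mult
  d := so3Dim t
  unit_mul ξ := by
    ext k
    rw [so3Mult_apply, Finsupp.single_apply]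
    refine if_congr ?_ rfl rfl
    simp only [Nat.dist]
    omega
  mul_unit ξ := by
    ext k
    rw [so3Mult_apply, Finsupp.single_apply]
    refine if_congr ?_ rfl rfl
    simp only [Nat.dist]
    omega
  mul_assoc := so3Mult_assoc
  conj_conj _ := rfl
  conj_mul ξ η α := by
    simp only [so3Mult_apply, id]
    refine if_congr ?_ rfl rfl
    simp only [Nat.dist]
    omega
  frobenius_right ξ η α := by
    simp only [so3Mult_apply, id]
    refine if_congr ?_ rfl rfl
    simp only [Nat.dist]
    omega
  frobenius_left ξ η α := by
    simp only [so3Mult_apply, id]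
    refine if_congr ?_ rfl rfl
    simp only [Nat.dist]
    omega
  d_mul := so3Dim_mul t
  d_conj _ := rfl
  one_le_d n := (so3Dim_mono ht n).1

theorem three_le_qnumber {q : ℝ} (hq : 0 < q) : 3 ≤ q ^ 2 + (q ^ 2)⁻¹ + 1 := by
  have h : 0 < q ^ 2 := by positivity
  have h1 : q ^ 2 * (q ^ 2)⁻¹ = 1 := mul_inv_cancel₀ h.ne'
  nlinarith [sq_nonneg (q ^ 2 - (q ^ 2)⁻¹), inv_pos.2 h]

/-- The fusion algebra `R(SO_q(3))` with its quantum dimension function, which is determined by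
`d(1) = [3]_q = q² + q⁻² + 1`. -/
noncomputable def quantumSO3 (q : ℝ) (hq : 0 < q) : FusionAlgebra.{0} :=
  so3Fusion (q ^ 2 + (q ^ 2)⁻¹ + 1) (three_le_qnumber hq)

theorem three_le_natCast_sub_one {N : ℕ} (hN : 4 ≤ N) : (3 : ℝ) ≤ (N : ℝ) - 1 := by
  have : (4 : ℝ) ≤ N := by exact_mod_cast hN
  linarith

/-- The fusion algebra `R(S_N⁺)` of the quantum permutation group, `N ≥ 4`: the fundamental
representation of dimension `N` is `0 ⊕ 1`, so that `d(1) = N - 1`. -/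
noncomputable def quantumPermutation (N : ℕ) (hN : 4 ≤ N) : FusionAlgebra.{0} :=
  so3Fusion ((N : ℝ) - 1) (three_le_natCast_sub_one hN)

/-! Put `p = q²`, so that `d(n) = p⁻ⁿ + ⋯ + pⁿ` and `d(n+1) ≥ p⁻¹ d(n)`.

Lower bounds: a generating set must contain some `k ≥ 1`. The translation `n ↦ n + k` is injective,
`n + k` occurs in `n ⊗ k`, and the weight `d²` grows by a factor of at least `p⁻²`. Such an
expanding map forces a large boundary on every finite set (`le_size_innerBoundary`,
`le_size_boundary`).

Upper bounds: take `X = {1}` and `A = {0, …, n}`, whose boundary lies in `{n, n+1}`. Both ratios are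
expressed through quotients of consecutive interval sizes, which tend to `p⁻²`
(`tendsto_so3Size_ratio`), so the lower bounds are attained in the limit, also when `p = 1`. -/

namespace FusionAlgebra

variable {F : FusionAlgebra.{u}}

/-! ### Size as a measure on finite sets. -/

theorem size_coe (A : Finset F.I) : F.size (A : Set F.I) = ∑ α ∈ A, F.d α ^ 2 :=
  finsum_mem_coe_finset _ _

theorem size_nonneg (S : Set F.I) : 0 ≤ F.size S :=
  finsum_nonneg fun _ => finsum_nonneg fun _ => sq_nonneg _

theorem size_pos {A : Finset F.I} (hA : A.Nonempty) : 0 < F.size (A : Set F.I) := by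
  rw [size_coe]
  exact Finset.sum_pos (fun α _ => pow_pos (zero_lt_one.trans_le (F.one_le_d α)) 2) hA

theorem size_mono {S T : Set F.I} (h : S ⊆ T) (hT : T.Finite) : F.size S ≤ F.size T := by
  lift S to Finset F.I using hT.subset h
  lift T to Finset F.I using hT
  rw [size_coe, size_coe]
  exact Finset.sum_le_sum_of_subset_of_nonneg (Finset.coe_subset.1 h) fun _ _ _ => sq_nonneg _

theorem size_union {S T : Set F.I} (h : Disjoint S T) (hS : S.Finite) (hT : T.Finite) :
    F.size (S ∪ T) = F.size S + F.size T :=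
  finsum_mem_union h hS hT

theorem mul_size_le_size_image {σ : F.I → F.I} (hσ : Function.Injective σ) {c : ℝ}
    (hd : ∀ α, c * F.d α ^ 2 ≤ F.d (σ α) ^ 2) {S : Set F.I} (hS : S.Finite) :
    c * F.size S ≤ F.size (σ '' S) := by
  classical
  lift S to Finset F.I using hS
  rw [← Finset.coe_image, size_coe, size_coe, Finset.sum_image hσ.injOn, Finset.mul_sum]
  exact Finset.sum_le_sum fun α _ => hd α

/-! ### Isoperimetric inequalities from an expanding injection. -/

section Expanding

variable {σ : F.I → F.I} {c : ℝ} {x : F.I} {X : Finset F.I}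

/-- Points of `A` off the inner boundary are mapped by `σ` back into `A`, so their total size is at
most `c⁻¹` times that of `A`. -/
theorem le_size_innerBoundary (hσ : Function.Injective σ) (hc : 0 < c)
    (hd : ∀ α, c * F.d α ^ 2 ≤ F.d (σ α) ^ 2) (hx : x ∈ X)
    (hsupp : ∀ α, σ α ∈ (F.N α x).support) (A : Finset F.I) :
    (1 - c⁻¹) * F.size (A : Set F.I) ≤ F.size (F.innerBoundary X A) := by
  have hsub : F.innerBoundary X A ⊆ A := fun α hα => hα.1
  have h1 : F.size (A : Set F.I) =
      F.size (F.innerBoundary X A) + F.size ((A : Set F.I) \ F.innerBoundary X A) := by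
    rw [← size_union Set.disjoint_sdiff_right (A.finite_toSet.subset hsub)
      A.finite_toSet.sdiff, Set.union_sdiff_cancel hsub]
  have h2 : σ '' ((A : Set F.I) \ F.innerBoundary X A) ⊆ A := by
    rintro _ ⟨α, ⟨hα, hb⟩, rfl⟩
    by_contra h
    exact hb ⟨hα, x, hx, fun h' => h (h' _ (hsupp α))⟩
  have h3 := (mul_size_le_size_image hσ hd A.finite_toSet.sdiff).trans
    (size_mono h2 A.finite_toSet)
  have h4 := (le_inv_mul_iff₀ hc).2 h3
  linarith

/-- Since `α` occurs in `σ α · x`, the part of `σ(A)` outside `A` lies in the outer boundary `O`.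
Hence `c|A| ≤ |A| + |O|`, and the excess `c - 1` adds to the inner bound `1 - c⁻¹`. -/
theorem le_size_boundary (hσ : Function.Injective σ) (hc : 0 < c)
    (hd : ∀ α, c * F.d α ^ 2 ≤ F.d (σ α) ^ 2) (hx : x ∈ X)
    (hsupp : ∀ α, σ α ∈ (F.N α x).support) (hsupp' : ∀ α, α ∈ (F.N (σ α) x).support)
    (A : Finset F.I) :
    (c - c⁻¹) * F.size (A : Set F.I) ≤ F.size (F.boundary X A) := by
  set O : Set F.I := {α | α ∉ A ∧ ∃ x ∈ X, ¬ (∀ β ∈ (F.N α x).support, β ∉ A)} with hO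
  have hfin := F.finite_boundary X A
  have hb : F.boundary X A = F.innerBoundary X A ∪ O := rfl
  have hOfin : O.Finite := hfin.subset (hb ▸ Set.subset_union_right)
  have hsub : F.innerBoundary X A ⊆ A := fun α hα => hα.1
  have hAO : Disjoint (A : Set F.I) O := Set.disjoint_left.2 fun α hα h => h.1 hα
  rw [hb, size_union (hAO.mono_left hsub) (A.finite_toSet.subset hsub) hOfin]
  have h2 : σ '' (A : Set F.I) ⊆ A ∪ O := by
    rintro _ ⟨α, hα, rfl⟩
    by_cases h : σ α ∈ A
    · exact Or.inl h
    · exact Or.inr ⟨h, x, hx, fun h' => h' _ (hsupp' α) hα⟩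
  have h3 := (mul_size_le_size_image hσ hd A.finite_toSet).trans
    (size_mono h2 (A.finite_toSet.union hOfin))
  rw [size_union hAO A.finite_toSet hOfin] at h3
  have h4 := le_size_innerBoundary hσ hc hd hx hsupp A
  linarith

end Expanding

/-! ### Passing between the infima and individual sets. -/

section Infima

theorem bddBelow_ratio (f : {A : Finset F.I // A.Nonempty} → Set F.I) :
    BddBelow (Set.range fun A : {A : Finset F.I // A.Nonempty} =>
      F.size (f A) / F.size (A : Finset F.I)) :=
  ⟨0, by rintro _ ⟨A, rfl⟩; exact div_nonneg (size_nonneg _) (size_nonneg _)⟩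

theorem iInf_ratio_nonneg (f : {A : Finset F.I // A.Nonempty} → Set F.I) :
    0 ≤ ⨅ A : {A : Finset F.I // A.Nonempty}, F.size (f A) / F.size (A : Finset F.I) :=
  Real.iInf_nonneg fun _ => div_nonneg (size_nonneg _) (size_nonneg _)

theorem folInn_le {X : Finset F.I} (hX : F.Generates X) {A : Finset F.I} (hA : A.Nonempty) :
    F.folInn ≤ F.size (F.innerBoundary X A) / F.size (A : Set F.I) :=
  (ciInf_le ⟨0, by rintro _ ⟨Y, rfl⟩; exact iInf_ratio_nonneg _⟩
    (⟨X, hX⟩ : {X : Finset F.I // F.Generates X})).trans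
    (ciInf_le (bddBelow_ratio fun A => F.innerBoundary X A)
      (⟨A, hA⟩ : {A : Finset F.I // A.Nonempty}))

theorem fol_le {X : Finset F.I} (hX : F.Generates X) {A : Finset F.I} (hA : A.Nonempty) :
    F.fol ≤ F.size (F.boundary X A) / F.size (A : Set F.I) :=
  (ciInf_le ⟨0, by rintro _ ⟨Y, rfl⟩; exact iInf_ratio_nonneg _⟩
    (⟨X, hX⟩ : {X : Finset F.I // F.Generates X})).trans
    (ciInf_le (bddBelow_ratio fun A => F.boundary X A)
      (⟨A, hA⟩ : {A : Finset F.I // A.Nonempty}))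

/-- Finite generation makes the index type of the infimum non-empty; a real infimum over an empty
type would be `0`. -/
theorem le_folInn (hF : F.FinitelyGenerated) {c : ℝ}
    (h : ∀ X, F.Generates X → ∀ A : Finset F.I,
      c * F.size (A : Set F.I) ≤ F.size (F.innerBoundary X A)) : c ≤ F.folInn := by
  obtain ⟨X, hX⟩ := hF
  have : Nonempty {X : Finset F.I // F.Generates X} := ⟨⟨X, hX⟩⟩
  have : Nonempty {A : Finset F.I // A.Nonempty} := ⟨⟨{F.e}, Finset.singleton_nonempty _⟩⟩
  exact le_ciInf fun Y => le_ciInf fun A => (le_div_iff₀ (size_pos A.2)).2 (h Y Y.2 A)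

theorem le_fol (hF : F.FinitelyGenerated) {c : ℝ}
    (h : ∀ X, F.Generates X → ∀ A : Finset F.I,
      c * F.size (A : Set F.I) ≤ F.size (F.boundary X A)) : c ≤ F.fol := by
  obtain ⟨X, hX⟩ := hF
  have : Nonempty {X : Finset F.I // F.Generates X} := ⟨⟨X, hX⟩⟩
  have : Nonempty {A : Finset F.I // A.Nonempty} := ⟨⟨{F.e}, Finset.singleton_nonempty _⟩⟩
  exact le_ciInf fun Y => le_ciInf fun A => (le_div_iff₀ (size_pos A.2)).2 (h Y Y.2 A)

end Infima

end FusionAlgebra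

/-! ### Growth of the dimensions and of the interval sizes. -/

section QuantumInteger

variable {p : ℝ}

/-- First-order form of the recurrence, read off from `d(n) = p⁻ⁿ + ⋯ + pⁿ`: multiplying by `p⁻¹`
shifts the exponents down by one and loses the top two terms. -/
theorem so3Dim_succ (hp : 0 < p) (n : ℕ) :
    so3Dim (p + p⁻¹ + 1) (n + 1) = p⁻¹ * so3Dim (p + p⁻¹ + 1) n + p ^ n + p ^ (n + 1) := by
  induction n with
  | zero => simp only [so3Dim]; ring
  | succ n ih =>
    have h : so3Dim (p + p⁻¹ + 1) n =
        p * (so3Dim (p + p⁻¹ + 1) (n + 1) - p ^ n - p ^ (n + 1)) := by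
      rw [ih]; field_simp; ring
    rw [so3Dim, h]
    ring

theorem pow_mul_so3Dim_le (hp : 0 < p) (hp1 : p ≤ 1) (n : ℕ) :
    p ^ n * so3Dim (p + p⁻¹ + 1) n ≤ 2 * n + 1 := by
  induction n with
  | zero => simp [so3Dim]
  | succ n ih =>
    have h : p ^ (n + 1) * so3Dim (p + p⁻¹ + 1) (n + 1) =
        p ^ n * so3Dim (p + p⁻¹ + 1) n + p ^ (n + 1) * p ^ n + p ^ (n + 1) * p ^ (n + 1) := by
      rw [so3Dim_succ hp]; field_simp; ring
    have h1 : p ^ n ≤ 1 := pow_le_one₀ hp.le hp1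
    have h2 : p ^ (n + 1) ≤ 1 := pow_le_one₀ hp.le hp1
    have h3 : p ^ (n + 1) * p ^ n ≤ 1 := mul_le_one₀ h2 (by positivity) h1
    have h4 : p ^ (n + 1) * p ^ (n + 1) ≤ 1 := mul_le_one₀ h2 (by positivity) h2
    rw [h]
    push_cast
    linarith

theorem le_so3Dim {t : ℝ} (ht : 3 ≤ t) (n : ℕ) :
    2 * (n : ℝ) + 1 ≤ so3Dim t n ∧ so3Dim t n + 2 ≤ so3Dim t (n + 1) := by
  induction n with
  | zero => exact ⟨by simp [so3Dim], by simp only [so3Dim]; linarith⟩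
  | succ n ih =>
    refine ⟨by push_cast; linarith [ih.1, ih.2], ?_⟩
    rw [so3Dim]
    nlinarith [ih.1, ih.2, (so3Dim_mono ht (n + 1)).1]

theorem inv_sq_mul_so3Dim_sq_le (hp : 0 < p) (ht : 3 ≤ p + p⁻¹ + 1) {m n : ℕ}
    (h : m < n) :
    (p ^ 2)⁻¹ * so3Dim (p + p⁻¹ + 1) m ^ 2 ≤ so3Dim (p + p⁻¹ + 1) n ^ 2 := by
  have h0 := (so3Dim_mono ht m).1
  have h1 : so3Dim (p + p⁻¹ + 1) (m + 1) ≤ so3Dim (p + p⁻¹ + 1) n :=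
    monotone_nat_of_le_succ (fun k => (so3Dim_mono ht k).2) h
  rw [← inv_pow, ← mul_pow]
  refine pow_le_pow_left₀ (by positivity) (le_trans ?_ h1) 2
  rw [so3Dim_succ hp]
  have : 0 < p ^ m := by positivity
  have : 0 < p ^ (m + 1) := by positivity
  linarith

/-- The size of the interval `{0, …, n}`. -/
noncomputable def so3Size (t : ℝ) (n : ℕ) : ℝ := ∑ i ∈ Finset.range (n + 1), so3Dim t i ^ 2

theorem so3Size_succ (t : ℝ) (n : ℕ) :
    so3Size t (n + 1) = so3Size t n + so3Dim t (n + 1) ^ 2 :=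
  Finset.sum_range_succ _ _

/-- Cubic growth is the worst case `t = 3`, where `d(n) = 2n + 1`. -/
theorem cube_le_so3Size {t : ℝ} (ht : 3 ≤ t) (n : ℕ) : ((n : ℝ) + 1) ^ 3 ≤ so3Size t n := by
  induction n with
  | zero => simp [so3Size, so3Dim]
  | succ n ih =>
    rw [so3Size_succ]
    have h := (le_so3Dim ht (n + 1)).1
    have h2 := pow_le_pow_left₀ (by positivity) h 2
    push_cast at h2 ⊢
    nlinarith [(Nat.cast_nonneg n : (0 : ℝ) ≤ n)]

/-- Squaring `d(i+1) = p⁻¹ d(i) + pⁱ + pⁱ⁺¹` leaves an error linear in `i`, because `pⁱ d(i) ≤ 2i +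
1`. Summation gives a quadratic error, negligible against the cubic growth of the size for every `p
≤ 1`. -/
theorem so3Size_succ_bounds (hp : 0 < p) (hp1 : p ≤ 1) (ht : 3 ≤ p + p⁻¹ + 1) (n : ℕ) :
    (p ^ 2)⁻¹ * so3Size (p + p⁻¹ + 1) n ≤ so3Size (p + p⁻¹ + 1) (n + 1) ∧
    so3Size (p + p⁻¹ + 1) (n + 1) ≤
      (p ^ 2)⁻¹ * so3Size (p + p⁻¹ + 1) n + 9 * ((n : ℝ) + 1) ^ 2 * p⁻¹ := by
  have hpi : 1 ≤ p⁻¹ := (one_le_inv₀ hp).2 hp1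
  have step : ∀ i : ℕ, so3Dim (p + p⁻¹ + 1) (i + 1) ^ 2 ≤
      (p ^ 2)⁻¹ * so3Dim (p + p⁻¹ + 1) i ^ 2 + 8 * ((i : ℝ) + 1) * p⁻¹ := by
    intro i
    have h1 := pow_mul_so3Dim_le hp hp1 i
    have hd := (so3Dim_mono ht i).1
    rw [so3Dim_succ hp]
    set D := so3Dim (p + p⁻¹ + 1) i
    have ha : p ^ i ≤ 1 := pow_le_one₀ hp.le hp1
    have ha0 : 0 < p ^ i := by positivity
    have he : p ^ (i + 1) ≤ p ^ i := pow_le_pow_of_le_one hp.le hp1 (Nat.le_succ i)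
    have he0 : 0 < p ^ (i + 1) := by positivity
    set a := p ^ i
    set b := p ^ (i + 1)
    have e1 : (a + b) * D ≤ 2 * (2 * i + 1) := by nlinarith
    have e2 : (a + b) ^ 2 ≤ 4 := by nlinarith
    have e3 : (a + b) * D * p⁻¹ ≤ 2 * (2 * i + 1) * p⁻¹ := by gcongr
    rw [← inv_pow]
    nlinarith
  -- The constant `9` is the `8` of `step` plus one to absorb the extra term `d(0)² = 1`.
  induction n with
  | zero =>
    have := step 0
    have h' := inv_sq_mul_so3Dim_sq_le hp ht zero_lt_one
    rw [so3Size_succ]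
    simp only [so3Size, zero_add, Finset.sum_range_one, so3Dim, Nat.cast_zero] at this h' ⊢
    constructor <;> linarith
  | succ n ih =>
    have := step (n + 1)
    have h' := inv_sq_mul_so3Dim_sq_le hp ht (Nat.lt_succ_self (n + 1))
    rw [so3Size_succ _ (n + 1), so3Size_succ _ n, mul_add, ← so3Size_succ _ n]
    refine ⟨by linarith [ih.1], ?_⟩
    have h9 : 9 * ((n : ℝ) + 1) ^ 2 * p⁻¹ + 8 * ((n : ℝ) + 1 + 1) * p⁻¹ ≤
        9 * ((n : ℝ) + 1 + 1) ^ 2 * p⁻¹ := by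
      rw [← add_mul]
      gcongr
      nlinarith [(Nat.cast_nonneg n : (0 : ℝ) ≤ n)]
    push_cast at this ⊢
    linarith [ih.2]

theorem tendsto_so3Size_ratio (hp : 0 < p) (hp1 : p ≤ 1) (ht : 3 ≤ p + p⁻¹ + 1) :
    Filter.Tendsto (fun n => so3Size (p + p⁻¹ + 1) (n + 1) / so3Size (p + p⁻¹ + 1) n)
      Filter.atTop (nhds (p ^ 2)⁻¹) := by
  have hlim : Filter.Tendsto (fun n : ℕ => (p ^ 2)⁻¹ + 9 * p⁻¹ * (1 / ((n : ℝ) + 1)))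
      Filter.atTop (nhds (p ^ 2)⁻¹) := by
    simpa using (tendsto_one_div_add_atTop_nhds_zero_nat (𝕜 := ℝ)).const_mul (9 * p⁻¹)
      |>.const_add ((p ^ 2)⁻¹)
  refine tendsto_of_tendsto_of_tendsto_of_le_of_le tendsto_const_nhds hlim (fun n => ?_)
    fun n => ?_
  all_goals
    have h := so3Size_succ_bounds hp hp1 ht n
    have hc := cube_le_so3Size ht n
    have hn : (0 : ℝ) < n + 1 := by positivity
    have hS : 0 < so3Size (p + p⁻¹ + 1) n := lt_of_lt_of_le (by positivity) hc
  · exact (le_div_iff₀ hS).2 h.1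
  · refine (div_le_iff₀ hS).2 (h.2.trans ?_)
    rw [add_mul]
    refine add_le_add le_rfl ?_
    have : 9 * ((n : ℝ) + 1) ^ 2 * p⁻¹ = 9 * p⁻¹ * (1 / (n + 1)) * ((n : ℝ) + 1) ^ 3 := by
      field_simp
    rw [this]
    gcongr

end QuantumInteger

/-! ### Structure forced by the fusion rules. -/

namespace FusionAlgebra.HasSO3FusionRules

variable {F : FusionAlgebra.{u}} {φ : ℕ ≃ F.I}

theorem mem_support (h : F.HasSO3FusionRules φ) (m n k : ℕ) :
    φ k ∈ (F.N (φ m) (φ n)).support ↔ Nat.dist m n ≤ k ∧ k ≤ m + n := by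
  rw [Finsupp.mem_support_iff, h m n k]
  simp

/-- If `j` labels the unit, then `2j` occurs in `j ⊗ j = j`, so `j = 0`. -/
theorem unit_eq (h : F.HasSO3FusionRules φ) : F.e = φ 0 := by
  obtain ⟨j, hj⟩ := φ.surjective F.e
  have h1 := (h.mem_support j j (j + j)).2 ⟨by simp, le_rfl⟩
  rw [hj, F.unit_mul, Finsupp.support_single _ one_ne_zero, Finset.mem_singleton, ← hj,
    φ.injective.eq_iff] at h1
  rw [← hj, show j = 0 by omega]

/-- By reciprocity the unit occurs in `n ⊗ n̄`, while `0` occurs in `n ⊗ m` only for `m = n`. -/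
theorem conj_eq (h : F.HasSO3FusionRules φ) (n : ℕ) : F.conj (φ n) = φ n := by
  obtain ⟨m, hm⟩ := φ.surjective (F.conj (φ n))
  have h1 := F.frobenius_right F.e (φ n) (φ n)
  rw [F.unit_mul, Finsupp.single_eq_same, ← hm, h.unit_eq, h n m 0] at h1
  have h2 : Nat.dist n m ≤ 0 := by
    by_contra h'
    simp [h'] at h1
  rw [← hm, Nat.eq_of_dist_eq_zero (Nat.le_zero.1 h2)]

theorem mult_eq (h : F.HasSO3FusionRules φ) (m n : ℕ) :
    F.N (φ m) (φ n) = (so3Mult m n).mapDomain φ := by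
  ext α
  obtain ⟨k, rfl⟩ := φ.surjective α
  rw [h m n k, Finsupp.mapDomain_apply φ.injective, so3Mult_apply]

theorem dim_eq (h : F.HasSO3FusionRules φ) (n : ℕ) : F.d (φ n) = so3Dim (F.d (φ 1)) n := by
  have hmul : ∀ m n, F.d (φ m) * F.d (φ n) =
      ∑ k ∈ Finset.Icc (Nat.dist m n) (m + n), F.d (φ k) := by
    intro m n
    rw [F.d_mul, h.mult_eq, Finsupp.sum_mapDomain_index (by simp) (by intros; push_cast; ring),
      so3Mult_sum _ _ _ (by simp)]
    simp
  induction n using Nat.twoStepInduction with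
  | zero =>
    have h0 := hmul 0 0
    simp only [Nat.dist_self, add_zero, Finset.Icc_self, Finset.sum_singleton] at h0
    have h1 := F.one_le_d (φ 0)
    rw [so3Dim]
    nlinarith
  | one => rfl
  | more n h0 h1 =>
    have h2 := hmul (n + 1) 1
    have h3 : Finset.Icc (Nat.dist (n + 1) 1) (n + 1 + 1) = {n, n + 1, n + 2} := by
      ext k
      simp only [Nat.dist, Finset.mem_Icc, Finset.mem_insert, Finset.mem_singleton]
      omega
    rw [h3, Finset.sum_insert (by simp), Finset.sum_insert (by simp), Finset.sum_singleton] at h2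
    rw [so3Dim, ← h0, ← h1]
    linarith

theorem mem_support_prod_replicate (h : F.HasSO3FusionRules φ) (n : ℕ) :
    φ n ∈ (F.prod (List.replicate n (φ 1))).support := by
  induction n with
  | zero =>
    rw [List.replicate_zero, prod, h.unit_eq]
    simp
  | succ n ih =>
    rw [List.replicate_succ, prod]
    rw [Finsupp.mem_support_iff, Finsupp.sum_apply, Finsupp.sum]
    refine (Finset.sum_pos' (fun _ _ => Nat.zero_le _) ⟨φ n, ih, ?_⟩).ne'
    rw [Finsupp.smul_apply, smul_eq_mul]
    refine Nat.mul_pos (Nat.pos_of_ne_zero (Finsupp.mem_support_iff.1 ih)) (Nat.pos_of_ne_zero ?_)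
    rw [← Finsupp.mem_support_iff, h.mem_support]
    simp only [Nat.dist]
    omega

theorem generates_singleton (h : F.HasSO3FusionRules φ) : F.Generates {φ 1} := by
  refine ⟨fun x hx => ?_, fun α => ?_⟩
  · rw [Finset.mem_singleton] at hx ⊢
    rw [hx, h.conj_eq]
  · obtain ⟨n, rfl⟩ := φ.surjective α
    rcases Nat.eq_zero_or_pos n with rfl | hn
    · refine ⟨[φ 1, φ 1], by simp, by simp, ?_⟩
      have h1 : F.prod [φ 1, φ 1] = F.N (φ 1) (φ 1) := by
        simp [prod, F.mul_unit]
      rw [h1, h.mem_support]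
      simp
    · refine ⟨List.replicate n (φ 1), by simp; omega, fun x hx => ?_,
        h.mem_support_prod_replicate n⟩
      rw [List.eq_of_mem_replicate hx]
      exact Finset.mem_singleton_self _

/-- Otherwise `X ⊆ {e}`, and words in `X` produce only the unit. -/
theorem exists_mem_of_generates (h : F.HasSO3FusionRules φ) {X : Finset F.I}
    (hX : F.Generates X) : ∃ k, 1 ≤ k ∧ φ k ∈ X := by
  by_contra! hk
  have hX0 : ∀ x ∈ X, x = F.e := by
    intro x hx
    obtain ⟨k, rfl⟩ := φ.surjective x
    rcases Nat.eq_zero_or_pos k with rfl | hk'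
    · exact h.unit_eq.symm
    · exact absurd hx (hk k hk')
  have hprod : ∀ l : List F.I, (∀ x ∈ l, x ∈ X) → F.prod l = Finsupp.single F.e 1 := by
    intro l
    induction l with
    | nil => intro _; rfl
    | cons x l ih =>
      intro hl
      rw [prod, ih fun y hy => hl y (List.mem_cons_of_mem _ hy), hX0 x (hl x List.mem_cons_self)]
      simp [F.unit_mul]
  obtain ⟨l, -, hl, h1⟩ := hX.2 (φ 1)
  rw [hprod l hl, Finsupp.support_single _ one_ne_zero, Finset.mem_singleton, h.unit_eq,
    φ.injective.eq_iff] at h1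
  exact one_ne_zero h1

/-- Translation by `k` in the labelling `φ`. -/
def shift (φ : ℕ ≃ F.I) (k : ℕ) (α : F.I) : F.I := φ (φ.symm α + k)

theorem shift_injective (k : ℕ) : Function.Injective (shift φ k) := fun α β hαβ => by
  simpa [shift] using hαβ

theorem shift_mem_support (h : F.HasSO3FusionRules φ) (k : ℕ) (α : F.I) :
    shift φ k α ∈ (F.N α (φ k)).support := by
  obtain ⟨n, rfl⟩ := φ.surjective α
  rw [shift, h.mem_support, φ.symm_apply_apply]
  simp only [Nat.dist]
  omega

/-- Here `n` is the lowest constituent of `(n + k) ⊗ k`, just as `n + k` is the highest one of `n ⊗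
k`. -/
theorem mem_support_shift (h : F.HasSO3FusionRules φ) (k : ℕ) (α : F.I) :
    α ∈ (F.N (shift φ k α) (φ k)).support := by
  obtain ⟨n, rfl⟩ := φ.surjective α
  rw [shift, h.mem_support, φ.symm_apply_apply]
  simp only [Nat.dist]
  omega

/-! ### Intervals as test sets, and the two constants. -/

theorem innerBoundary_subset (h : F.HasSO3FusionRules φ) (n : ℕ) :
    F.innerBoundary {φ 1} ((Finset.range (n + 1)).map φ.toEmbedding) ⊆ {φ n} := by
  rintro α ⟨hα, x, hx, hn⟩
  obtain ⟨m, rfl⟩ := φ.surjective α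
  rw [Finset.mem_singleton] at hx
  subst hx
  push Not at hn
  obtain ⟨β, hβ, hA⟩ := hn
  obtain ⟨k, rfl⟩ := φ.surjective β
  rw [h.mem_support] at hβ
  simp only [Finset.mem_map_equiv, φ.symm_apply_apply, Finset.mem_range] at hα hA
  rw [Set.mem_singleton_iff, show m = n by omega]

theorem boundary_subset (h : F.HasSO3FusionRules φ) (n : ℕ) :
    F.boundary {φ 1} ((Finset.range (n + 1)).map φ.toEmbedding) ⊆ {φ n, φ (n + 1)} := by
  rintro α (hα | ⟨hα, x, hx, hn⟩)
  · exact Or.inl (h.innerBoundary_subset n hα)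
  obtain ⟨m, rfl⟩ := φ.surjective α
  rw [Finset.mem_singleton] at hx
  subst hx
  push Not at hn
  obtain ⟨β, hβ, hA⟩ := hn
  obtain ⟨k, rfl⟩ := φ.surjective β
  rw [h.mem_support] at hβ
  simp only [Finset.mem_map_equiv, φ.symm_apply_apply, Finset.mem_range, Nat.dist] at hα hA hβ
  exact Or.inr (by rw [Set.mem_singleton_iff, show m = n + 1 by omega])

theorem size_map_range (h : F.HasSO3FusionRules φ) (n : ℕ) :
    F.size ((Finset.range (n + 1)).map φ.toEmbedding : Finset F.I) =
      so3Size (F.d (φ 1)) n := by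
  rw [size_coe, Finset.sum_map, so3Size]
  exact Finset.sum_congr rfl fun i _ => by rw [Equiv.coe_toEmbedding, h.dim_eq i]

theorem folInn_le_ratio (h : F.HasSO3FusionRules φ) (n : ℕ) :
    F.folInn ≤ so3Dim (F.d (φ 1)) n ^ 2 / so3Size (F.d (φ 1)) n := by
  refine (folInn_le h.generates_singleton
    (A := (Finset.range (n + 1)).map φ.toEmbedding) (by simp)).trans ?_
  have h1 := size_mono (h.innerBoundary_subset n) (Set.finite_singleton _)
  have h2 : F.size {φ n} = so3Dim (F.d (φ 1)) n ^ 2 := by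
    rw [← Finset.coe_singleton, size_coe, Finset.sum_singleton, h.dim_eq n]
  rw [← h.size_map_range n, ← h2]
  exact div_le_div_of_nonneg_right h1 (size_nonneg _)

theorem fol_le_ratio (h : F.HasSO3FusionRules φ) (n : ℕ) :
    F.fol ≤ (so3Dim (F.d (φ 1)) n ^ 2 + so3Dim (F.d (φ 1)) (n + 1) ^ 2) /
      so3Size (F.d (φ 1)) n := by
  classical
  refine (fol_le h.generates_singleton
    (A := (Finset.range (n + 1)).map φ.toEmbedding) (by simp)).trans ?_
  have h1 := size_mono (h.boundary_subset n) (Set.toFinite _)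
  have h2 : F.size {φ n, φ (n + 1)} =
      so3Dim (F.d (φ 1)) n ^ 2 + so3Dim (F.d (φ 1)) (n + 1) ^ 2 := by
    rw [← Finset.coe_pair, size_coe, Finset.sum_pair (by simp), h.dim_eq n, h.dim_eq (n + 1)]
  rw [← h.size_map_range n, ← h2]
  exact div_le_div_of_nonneg_right h1 (size_nonneg _)

theorem folner_constants (h : F.HasSO3FusionRules φ) {p : ℝ} (hp : 0 < p) (hp1 : p ≤ 1)
    (hd : F.d (φ 1) = p + p⁻¹ + 1) :
    F.FinitelyGenerated ∧ F.folInn = 1 - p ^ 2 ∧ F.fol = (p ^ 2)⁻¹ - p ^ 2 := by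
  have hfg : F.FinitelyGenerated := ⟨_, h.generates_singleton⟩
  have hpi : p * p⁻¹ = 1 := mul_inv_cancel₀ hp.ne'
  have ht : 3 ≤ p + p⁻¹ + 1 := by nlinarith [sq_nonneg (p - p⁻¹), inv_pos.2 hp]
  have hgrow : ∀ k, 1 ≤ k → ∀ α, (p ^ 2)⁻¹ * F.d α ^ 2 ≤ F.d (shift φ k α) ^ 2 := by
    intro k hk α
    obtain ⟨n, rfl⟩ := φ.surjective α
    rw [shift, φ.symm_apply_apply, h.dim_eq n, h.dim_eq (n + k), hd]
    exact inv_sq_mul_so3Dim_sq_le hp ht (by omega)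
  have hc : 0 < (p ^ 2)⁻¹ := by positivity
  have hlim := tendsto_so3Size_ratio hp hp1 ht
  have hS : ∀ n, 0 < so3Size (p + p⁻¹ + 1) n := fun n =>
    lt_of_lt_of_le (by positivity) (cube_le_so3Size ht n)
  have hinn : Filter.Tendsto
      (fun n => so3Dim (p + p⁻¹ + 1) (n + 1) ^ 2 / so3Size (p + p⁻¹ + 1) (n + 1))
      Filter.atTop (nhds (1 - p ^ 2)) := by
    have h1 := (hlim.inv₀ hc.ne').const_sub 1
    rw [inv_inv] at h1
    -- With `S` the interval size, `d(n+1)² / S(n+1) = 1 - S(n) / S(n+1)`.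
    refine h1.congr fun n => ?_
    rw [inv_div, eq_div_iff (hS _).ne', sub_mul, div_mul_cancel₀ _ (hS _).ne', so3Size_succ]
    ring
  have hout : Filter.Tendsto
      (fun n => (so3Dim (p + p⁻¹ + 1) (n + 1) ^ 2 + so3Dim (p + p⁻¹ + 1) (n + 1 + 1) ^ 2) /
        so3Size (p + p⁻¹ + 1) (n + 1))
      Filter.atTop (nhds ((p ^ 2)⁻¹ - p ^ 2)) := by
    -- The outer point contributes `d(n+2)² / S(n+1) = S(n+2) / S(n+1) - 1`.
    have h1 := hinn.add (((Filter.tendsto_add_atTop_iff_nat 1).2 hlim).sub_const 1)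
    rw [show (1 - p ^ 2) + ((p ^ 2)⁻¹ - 1) = (p ^ 2)⁻¹ - p ^ 2 by ring] at h1
    refine h1.congr fun n => ?_
    rw [so3Size_succ _ (n + 1), add_div, add_div, div_self (hS _).ne']
    ring
  refine ⟨hfg, le_antisymm ?_ ?_, le_antisymm ?_ ?_⟩
  · exact ge_of_tendsto' hinn fun n => hd ▸ h.folInn_le_ratio (n + 1)
  · refine le_folInn hfg fun X hX A => ?_
    obtain ⟨k, hk, hkX⟩ := h.exists_mem_of_generates hX
    have := le_size_innerBoundary (shift_injective k) hc (hgrow k hk) hkX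
      (h.shift_mem_support k) A
    rwa [inv_inv] at this
  · exact ge_of_tendsto' hout fun n => hd ▸ h.fol_le_ratio (n + 1)
  · refine le_fol hfg fun X hX A => ?_
    obtain ⟨k, hk, hkX⟩ := h.exists_mem_of_generates hX
    have := le_size_boundary (shift_injective k) hc (hgrow k hk) hkX
      (h.shift_mem_support k) (h.mem_support_shift k) A
    rwa [inv_inv] at this

end FusionAlgebra.HasSO3FusionRules

/-! ### Specialisation to `SO_q(3)` and `S_N⁺`. -/

theorem FusionAlgebra.HasSO3FusionRules.folner_constants_of_sq {F : FusionAlgebra.{u}}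
    {φ : ℕ ≃ F.I} (h : F.HasSO3FusionRules φ) {q : ℝ} (hq : 0 < q) (hq1 : q ≤ 1)
    (hd : F.d (φ 1) = q ^ 2 + (q ^ 2)⁻¹ + 1) :
    F.FinitelyGenerated ∧ F.folInn = 1 - q ^ 4 ∧ F.fol = (q ^ 4)⁻¹ - q ^ 4 := by
  have h1 := h.folner_constants (pow_pos hq 2) (pow_le_one₀ hq.le hq1) hd
  rwa [← pow_mul] at h1

theorem so3Fusion_hasSO3FusionRules (t : ℝ) (ht : 3 ≤ t) :
    (so3Fusion t ht).HasSO3FusionRules (Equiv.refl ℕ) :=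
  so3Mult_apply

theorem quantumPermutation_folner_constants (N : ℕ) (hN : 4 ≤ N) :
    (quantumPermutation N hN).FinitelyGenerated ∧
      (quantumPermutation N hN).folInn =
        1 - ((N : ℝ) - 2 - √((N : ℝ) ^ 2 - 4 * N)) ^ 2 / 4 ∧
      (quantumPermutation N hN).fol =
        4 / ((N : ℝ) - 2 - √((N : ℝ) ^ 2 - 4 * N)) ^ 2 -
          ((N : ℝ) - 2 - √((N : ℝ) ^ 2 - 4 * N)) ^ 2 / 4 := by
  have hN' : (4 : ℝ) ≤ N := by exact_mod_cast hN
  have hs0 := Real.sqrt_nonneg ((N : ℝ) ^ 2 - 4 * N)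
  have hs := Real.sq_sqrt (show 0 ≤ (N : ℝ) ^ 2 - 4 * N by nlinarith)
  set s := √((N : ℝ) ^ 2 - 4 * N)
  -- The two factors are the roots of `p² - (N - 2)p + 1`; the smaller one is `p`, the other `p⁻¹`,
  -- whence `p + p⁻¹ + 1 = N - 1`.
  have hmul : ((N : ℝ) - 2 - s) / 2 * (((N : ℝ) - 2 + s) / 2) = 1 := by linarith
  have hp : 0 < ((N : ℝ) - 2 - s) / 2 :=
    pos_of_mul_pos_left (hmul ▸ one_pos) (by linarith)
  have hp1 : ((N : ℝ) - 2 - s) / 2 ≤ 1 := by nlinarith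
  have hinv : (((N : ℝ) - 2 - s) / 2)⁻¹ = ((N : ℝ) - 2 + s) / 2 := inv_eq_of_mul_eq_one_right hmul
  have h := (so3Fusion_hasSO3FusionRules _ (three_le_natCast_sub_one hN)).folner_constants hp hp1
    (show (N : ℝ) - 1 = _ by rw [hinv]; ring)
  refine ⟨h.1, h.2.1.trans (by ring), h.2.2.trans ?_⟩
  rw [div_pow, inv_div]
  norm_num

theorem mainTheorem5 :
    -- the fusion algebra of `SO_q(3)`
    (∀ (q : ℝ) (hq : 0 < q), q ≤ 1 →
      (quantumSO3 q hq).FinitelyGenerated ∧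
      (quantumSO3 q hq).folInn = 1 - q ^ 4 ∧
      (quantumSO3 q hq).fol = (q ^ 4)⁻¹ - q ^ 4) ∧
    -- any fusion algebra with the same fusion rules and the same dimension of the generator
    (∀ (F : FusionAlgebra.{u}) (φ : ℕ ≃ F.I), F.HasSO3FusionRules φ →
      ∀ q : ℝ, 0 < q → q ≤ 1 → F.d (φ 1) = q ^ 2 + (q ^ 2)⁻¹ + 1 →
        F.FinitelyGenerated ∧ F.folInn = 1 - q ^ 4 ∧ F.fol = (q ^ 4)⁻¹ - q ^ 4) ∧
    -- the fusion algebras of the quantum permutation groups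
    (∀ (N : ℕ) (hN : 4 ≤ N),
      (quantumPermutation N hN).FinitelyGenerated ∧
      (quantumPermutation N hN).folInn =
        1 - ((N : ℝ) - 2 - √((N : ℝ) ^ 2 - 4 * N)) ^ 2 / 4 ∧
      (quantumPermutation N hN).fol =
        4 / ((N : ℝ) - 2 - √((N : ℝ) ^ 2 - 4 * N)) ^ 2 -
          ((N : ℝ) - 2 - √((N : ℝ) ^ 2 - 4 * N)) ^ 2 / 4) := by
  exact ⟨fun q hq hq1 => (so3Fusion_hasSO3FusionRules _ _).folner_constants_of_sq hq hq1 rfl,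
    fun F φ h q hq hq1 hd => h.folner_constants_of_sq hq hq1 hd,
    quantumPermutation_folner_constants⟩
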